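/- Let $K$ be an algebraically closed field of characteristic zero, let $n\ge 1$, and let $\mathbf{k}=(k_1,\dots,k_n)$ be a tuple of integers with all $k_j>1$. Let $A_{\mathbf k}=\langle x_1,\dots,x_n : x_j^{k_j}=1 \text{ for } 1\le j\le n\rangle$ as a unital associative $K$-algebra, which is isomorphic to the group algebra over $K$ of the free product $C_{\mathbf k}=C_{k_1}*\cdots*C_{k_n}$ of cyclic groups of orders $k_1,\dots,k_n$. Let mod-$A_{\mathbf k}$ be the category of right $A_{\mathbf k}$-modules that are finite dimensional over $K$; it is called semisimple if each of its objects is a direct sum of simple modules. (a) The category mod-$A_{\mathbf k}$ is semisimple if and only if it contains only finitely many isomorphism classes of simple modules. These two conditions hold if and only if $n=1$, equivalently, if and only if $C_{\mathbf k}$ is a finite cyclic group. (b) Suppose that mod-$A_{\mathbf k}$ contains infinitely many pairwise non-isomorphic simple modules. Then there is an upper bound on the $K$-dimensions of the simple modules of mod-$A_{\mathbf k}$ if and only if $\mathbf k=(2,2)$ (that is, $n=2$ and $k_1=k_2=2$), equivalently, if and only if $C_{\mathbf k}$ is isomorphic to $C_2*C_2$. -/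

import Mathlib

universe u v

section RightModules

variable (K : Type u) [Field K] (A : Type v) [Ring A] [Algebra K A]

/-- An object of the category mod-`A` of finite dimensional right modules of a `K`-algebra `A`.
A right `A`-module is a module over the opposite algebra, and the two actions of `K`
(directly and through `A`) agree. Carriers live in the universe of `K`, which contains a copy of
every finite dimensional `K`-vector space. -/
structure FDRightModule where
  carrier : Type u
  [addCommGroup : AddCommGroup carrier]
  [moduleK : Module K carrier]
  [moduleA : Module Aᵐᵒᵖ carrier]
  [isScalarTower : IsScalarTower K Aᵐᵒᵖ carrier]
  [finiteDimensional : FiniteDimensional K carrier]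

namespace FDRightModule

instance : CoeSort (FDRightModule K A) (Type u) := ⟨FDRightModule.carrier⟩

attribute [instance] addCommGroup moduleK moduleA isScalarTower finiteDimensional

/-- Isomorphism of right `A`-modules. -/
instance isoSetoid : Setoid (FDRightModule K A) where
  r M N := Nonempty (M ≃ₗ[Aᵐᵒᵖ] N)
  iseqv :=
    { refl := fun M => ⟨LinearEquiv.refl Aᵐᵒᵖ M⟩
      symm := fun ⟨e⟩ => ⟨e.symm⟩
      trans := fun ⟨e⟩ ⟨f⟩ => ⟨e.trans f⟩ }

/-- mod-`A` is semisimple: each of its objects is a semisimple module. -/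
def IsSemisimpleCat : Prop :=
  ∀ M : FDRightModule K A, IsSemisimpleModule Aᵐᵒᵖ M

/-- The set of isomorphism classes of simple modules of mod-`A`. -/
def simpleClasses : Set (Quotient (isoSetoid K A)) :=
  {q | ∃ M : FDRightModule K A, IsSimpleModule Aᵐᵒᵖ M ∧ Quotient.mk (isoSetoid K A) M = q}

/-- There is an upper bound on the `K`-dimensions of the simple modules of mod-`A`. -/
def HasBoundedSimples : Prop :=
  ∃ d : ℕ, ∀ M : FDRightModule K A, IsSimpleModule Aᵐᵒᵖ M → Module.finrank K M ≤ d

end FDRightModule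

end RightModules

/-- The free product `C_{k_1} * ⋯ * C_{k_n}` of the cyclic groups of orders `k_1, …, k_n`. -/
abbrev CyclicFreeProduct {n : ℕ} (k : Fin n → ℕ) : Type :=
  Monoid.CoprodI fun j : Fin n => Multiplicative (ZMod (k j))

/-- The defining relations `x_j ^ k_j = 1`. -/
inductive CyclicRel (K : Type u) [Field K] {n : ℕ} (k : Fin n → ℕ) :
    FreeAlgebra K (Fin n) → FreeAlgebra K (Fin n) → Prop
  | pow_eq_one (j : Fin n) : CyclicRel K k (FreeAlgebra.ι K j ^ k j) 1

/-- The unital associative `K`-algebra `⟨x_1, …, x_n : x_j ^ k_j = 1⟩`. -/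
abbrev CyclicAlgebra (K : Type u) [Field K] {n : ℕ} (k : Fin n → ℕ) : Type u :=
  RingQuot (CyclicRel K k)

/-!
A right module over `⟨x_1, …, x_n : x_j ^ k_j = 1⟩` is a vector space with operators `X_j` such that
`X_j ^ k_j = 1` (`FDRightModule.ofOperators`), and its submodules are the common invariant
subspaces of the `X_j`. Such operators can be prescribed by idempotents: if `e` is idempotent and
`z ^ m = 1`, then `stretch z e = 1 + (z - 1) e` has `m`-th power `1`, and it has the same invariant
subspaces as `e` when `z ≠ 1`.

If `n = 1`, the group is finite, and in characteristic zero Maschke's theorem makes the group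
algebra semisimple, so that there are finitely many simple modules. If `n ≥ 2`, two idempotents of
rank one in the plane, in a relative position measured by the trace `a` of their product, give
pairwise non-isomorphic modules,
simple for `a ≠ 0, 1` (`FDRightModule.infinite_simpleClasses`); for `a = 0` the module has an
invariant line without invariant complement (`FDRightModule.not_isSemisimpleCat`).

If `n ≥ 2` and `k ≠ (2, 2)`, there is room for three idempotents `e, f, g` with `f g = g f = 0`:
either a third generator is available, or a generator of order at least three, which can have three
eigenvalues and so carries both `f` and `g`. On `U × U × U` with `U = K ^ d`, let `f` and `g` be
two of the coordinate projections and let `e` be the product of the column `(1, A, B)` with the row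
`(1 - A - B, 1, 1)`. An invariant subspace is then controlled by a subspace of `U` invariant under
`A` and `A B` (`invariant_triple`), and for `A` diagonal with distinct eigenvalues and `B` a
suitable perturbation of the identity by an operator of rank one there are no proper ones
(`invariant_rampMul_rampShear`). This gives simple modules of dimension `3 d` for every `d > 0`.

For the infinite dihedral group, generated by involutions `s` and `t`, the element `s t + t s` is
central, hence a scalar on a simple module, and an eigenvector of `s` together with its image under
`t` spans it (`FDRightModule.finrank_le_two_of_involutions`). This bound only depends on the group
up to isomorphism, which closes the circle of equivalences.
-/

/-! ### The presented algebra and the group algebra -/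

section Presentation

variable (K : Type u) [Field K] {n : ℕ} (k : Fin n → ℕ)

/-- The generator `x_j` of the algebra `⟨x_1, …, x_n : x_j ^ k_j = 1⟩`. -/
def cyclicGen (j : Fin n) : CyclicAlgebra K k :=
  RingQuot.mkAlgHom K (CyclicRel K k) (FreeAlgebra.ι K j)

theorem cyclicGen_pow (j : Fin n) : cyclicGen K k j ^ k j = 1 := by
  rw [cyclicGen, ← map_pow, RingQuot.mkAlgHom_rel K (CyclicRel.pow_eq_one j), map_one]

variable {K k}

/-- The algebra homomorphism sending the generators to given elements that satisfy the defining
relations. -/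
def cyclicLift {B : Type v} [Ring B] [Algebra K B] (X : Fin n → B) (hX : ∀ j, X j ^ k j = 1) :
    CyclicAlgebra K k →ₐ[K] B :=
  RingQuot.liftAlgHom K ⟨FreeAlgebra.lift K X, by
    rintro _ _ ⟨j⟩
    simp [hX]⟩

@[simp]
theorem cyclicLift_gen {B : Type v} [Ring B] [Algebra K B] (X : Fin n → B)
    (hX : ∀ j, X j ^ k j = 1) (j : Fin n) : cyclicLift X hX (cyclicGen K k j) = X j := by
  simp [cyclicLift, cyclicGen]

theorem cyclicAlgebra_hom_ext {B : Type v} [Ring B] [Algebra K B]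
    {f g : CyclicAlgebra K k →ₐ[K] B}
    (h : ∀ j, f (cyclicGen K k j) = g (cyclicGen K k j)) : f = g := by
  apply RingQuot.ringQuot_ext'
  apply FreeAlgebra.hom_ext
  funext j
  exact h j

variable (K k)

theorem adjoin_range_cyclicGen : Algebra.adjoin K (Set.range (cyclicGen K k)) = ⊤ := by
  have h : Set.range (cyclicGen K k) =
      RingQuot.mkAlgHom K (CyclicRel K k) '' Set.range (FreeAlgebra.ι K) := by
    rw [← Set.range_comp]
    rfl
  rw [h, ← AlgHom.map_adjoin, FreeAlgebra.adjoin_range_ι, Algebra.map_top,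
    AlgHom.range_eq_top]
  exact RingQuot.mkAlgHom_surjective K _

end Presentation

theorem multiplicative_zmod_eq_pow {m : ℕ} (hm : m ≠ 0) (z : Multiplicative (ZMod m)) :
    z = .ofAdd 1 ^ (z.toAdd).val := by
  have : NeZero m := ⟨hm⟩
  rw [← ofAdd_nsmul, nsmul_one, ZMod.natCast_zmod_val, ofAdd_toAdd]

theorem monoidHom_multiplicative_zmod_ext {m : ℕ} (hm : m ≠ 0) {N : Type*} [Monoid N]
    {f g : Multiplicative (ZMod m) →* N}
    (h : f (.ofAdd 1) = g (.ofAdd 1)) : f = g := by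
  refine MonoidHom.ext fun z => ?_
  rw [multiplicative_zmod_eq_pow hm z, map_pow, map_pow, h]

/-- The homomorphism from the cyclic group of order `m` to a monoid sending the generator to an
element `a` with `a ^ m = 1`. -/
def zmodPowHom {m : ℕ} (hm : m ≠ 0) {N : Type*} [Monoid N] (a : N) (ha : a ^ m = 1) :
    Multiplicative (ZMod m) →* N :=
  (Units.coeHom N).comp <| AddMonoidHom.toMultiplicativeLeft <|
    ZMod.lift m ⟨zmultiplesHom (Additive Nˣ) (.ofMul (Units.ofPowEqOne a m ha hm)), by
      rw [zmultiplesHom_apply, natCast_zsmul, ← ofMul_pow, Units.pow_ofPowEqOne, ofMul_one]⟩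

@[simp]
theorem zmodPowHom_ofAdd_one {m : ℕ} (hm : m ≠ 0) {N : Type*} [Monoid N] (a : N)
    (ha : a ^ m = 1) : zmodPowHom hm a ha (.ofAdd 1) = a := by
  have h : ((1 : ℤ) : ZMod m) = 1 := Int.cast_one
  simp only [zmodPowHom, MonoidHom.comp_apply, AddMonoidHom.coe_toMultiplicativeLeft,
    Function.comp_apply, toAdd_ofAdd]
  rw [← h, ZMod.lift_coe]
  simp

/-- The algebra with generators `x_j` and relations `x_j ^ k_j = 1` is the group algebra of the
free product of the cyclic groups of orders `k_j`. -/
theorem nonempty_cyclicAlgebra_algEquiv (K : Type u) [Field K] {n : ℕ} (k : Fin n → ℕ)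
    (hk : ∀ j, k j ≠ 0) :
    Nonempty (CyclicAlgebra K k ≃ₐ[K] MonoidAlgebra K (CyclicFreeProduct k)) := by
  let g (j : Fin n) : CyclicFreeProduct k :=
    Monoid.CoprodI.of (M := fun j => Multiplicative (ZMod (k j))) (i := j) (.ofAdd 1)
  have hg (j : Fin n) : MonoidAlgebra.of K _ (g j) ^ k j = 1 := by
    rw [← map_pow, ← map_pow, ← ofAdd_nsmul, nsmul_one, ZMod.natCast_self, ofAdd_zero, map_one,
      map_one]
  let F : CyclicAlgebra K k →ₐ[K] MonoidAlgebra K (CyclicFreeProduct k) :=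
    cyclicLift (fun j => MonoidAlgebra.of K _ (g j)) hg
  let G : MonoidAlgebra K (CyclicFreeProduct k) →ₐ[K] CyclicAlgebra K k :=
    MonoidAlgebra.lift K _ _ (Monoid.CoprodI.lift fun j =>
      zmodPowHom (hk j) (cyclicGen K k j) (cyclicGen_pow K k j))
  have hGg (j : Fin n) : G (MonoidAlgebra.of K _ (g j)) = cyclicGen K k j := by
    simp only [G, g, MonoidAlgebra.lift_of, Monoid.CoprodI.lift_of, zmodPowHom_ofAdd_one]
  refine ⟨AlgEquiv.ofAlgHom F G ?_ ?_⟩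
  · refine MonoidAlgebra.algHom_ext' ?_ (Subsingleton.elim _ _)
    apply Monoid.CoprodI.ext_hom
    intro j
    apply monoidHom_multiplicative_zmod_ext (hk j)
    change F (G (MonoidAlgebra.of K _ (g j))) = MonoidAlgebra.of K _ (g j)
    rw [hGg, cyclicLift_gen]
  · apply cyclicAlgebra_hom_ext
    intro j
    change G (F (cyclicGen K k j)) = cyclicGen K k j
    rw [cyclicLift_gen, hGg]

/-! ### Right modules given by operators -/

namespace FDRightModule

variable {K : Type u} [Field K] {A : Type v} [Ring A] [Algebra K A]

open MulOpposite

/-- The elements of `A` whose right action preserves the `K`-subspace `W`. -/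
def stabilizer (M : FDRightModule K A) (W : Submodule K M) : Subalgebra K A where
  carrier := {a | ∀ w ∈ W, op a • w ∈ W}
  mul_mem' := fun {a b} ha hb w hw => by
    rw [op_mul, mul_smul]
    exact hb _ (ha _ hw)
  add_mem' := fun {a b} ha hb w hw => by
    rw [op_add, add_smul]
    exact W.add_mem (ha _ hw) (hb _ hw)
  algebraMap_mem' := fun c w hw => by
    rw [← MulOpposite.algebraMap_apply, algebraMap_smul]
    exact W.smul_mem c hw

/-- A `K`-subspace preserved by elements that generate `A` is a submodule. -/
theorem exists_submodule_of_adjoin_eq_top (M : FDRightModule K A) {s : Set A}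
    (hs : Algebra.adjoin K s = ⊤) (W : Submodule K M)
    (hW : ∀ a ∈ s, ∀ w ∈ W, op a • w ∈ W) :
    ∃ N : Submodule Aᵐᵒᵖ M, ∀ v, v ∈ N ↔ v ∈ W := by
  have htop : M.stabilizer W = ⊤ := top_le_iff.mp (hs ▸ Algebra.adjoin_le hW)
  refine ⟨{ W with smul_mem' := fun b w hw => ?_ }, fun v => Iff.rfl⟩
  have : unop b ∈ M.stabilizer W := htop ▸ Algebra.mem_top
  exact this w hw

/-- In a simple module, a `K`-subspace preserved by elements that generate `A` is everything as
soon as it is nonzero. -/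
theorem eq_top_of_adjoin_eq_top (M : FDRightModule K A) (hM : IsSimpleModule Aᵐᵒᵖ M) {s : Set A}
    (hs : Algebra.adjoin K s = ⊤) (W : Submodule K M)
    (hW : ∀ a ∈ s, ∀ w ∈ W, op a • w ∈ W) (hne : W ≠ ⊥) : W = ⊤ := by
  obtain ⟨N, hN⟩ := M.exists_submodule_of_adjoin_eq_top hs W hW
  obtain ⟨w, hw, hw0⟩ := W.ne_bot_iff.mp hne
  have hNtop : N = ⊤ := (eq_bot_or_eq_top N).resolve_left
    (N.ne_bot_iff.mpr ⟨w, (hN w).mpr hw, hw0⟩)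
  exact eq_top_iff.mpr fun v _ => (hN v).mp (hNtop ▸ Submodule.mem_top)

section Operators

variable {n : ℕ} {k : Fin n → ℕ} {V : Type u} [AddCommGroup V] [Module K V]
  [FiniteDimensional K V]

/-- The right module over `⟨x_1, …, x_n : x_j ^ k_j = 1⟩` on which `x_j` acts as the operator
`X j`. -/
def ofOperators (X : Fin n → Module.End K V) (hX : ∀ j, X j ^ k j = 1) :
    FDRightModule K (CyclicAlgebra K k) :=
  -- The action is a homomorphism from the opposite algebra, hence the opposite operators here.
  let f : (CyclicAlgebra K k)ᵐᵒᵖ →ₐ[K] Module.End K V :=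
    AlgHom.opComm (cyclicLift (fun j => op (X j)) fun j => by rw [← op_pow, hX, op_one])
  { carrier := V
    moduleA := Module.compHom V f.toRingHom
    isScalarTower := by
      let _ : Module (CyclicAlgebra K k)ᵐᵒᵖ V := Module.compHom V f.toRingHom
      exact ⟨fun c b v => by
        change f (c • b) v = c • f b v
        rw [map_smul, LinearMap.smul_apply]⟩ }

variable (X : Fin n → Module.End K V) (hX : ∀ j, X j ^ k j = 1)

theorem ofOperators_gen_smul (j : Fin n) (v : V) :
    (op (cyclicGen K k j) • (show ofOperators X hX from v) : ofOperators X hX) = X j v := by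
  change (AlgHom.opComm (cyclicLift (fun j => op (X j)) _)
    (op (cyclicGen K k j)) : Module.End K V) v = X j v
  simp [AlgHom.opComm]

/-- The underlying subspace of a submodule of `ofOperators X hX`. -/
def toSubspace (N : Submodule (CyclicAlgebra K k)ᵐᵒᵖ (ofOperators X hX)) : Submodule K V :=
  N.restrictScalars K

theorem mem_toSubspace (N : Submodule (CyclicAlgebra K k)ᵐᵒᵖ (ofOperators X hX)) (v : V) :
    v ∈ toSubspace X hX N ↔ (show ofOperators X hX from v) ∈ N :=
  Iff.rfl

theorem toSubspace_invariant (N : Submodule (CyclicAlgebra K k)ᵐᵒᵖ (ofOperators X hX))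
    (j : Fin n) : ∀ v ∈ toSubspace X hX N, X j v ∈ toSubspace X hX N := by
  intro v hv
  rw [mem_toSubspace, ← ofOperators_gen_smul X hX]
  exact N.smul_mem _ hv

theorem exists_submodule_ofOperators (W : Submodule K V) (hW : ∀ j, ∀ v ∈ W, X j v ∈ W) :
    ∃ N : Submodule (CyclicAlgebra K k)ᵐᵒᵖ (ofOperators X hX), toSubspace X hX N = W := by
  obtain ⟨N, hN⟩ := (ofOperators X hX).exists_submodule_of_adjoin_eq_top
    (adjoin_range_cyclicGen K k) W (by
      rintro _ ⟨j, rfl⟩ v hv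
      exact (congrArg (· ∈ W) (ofOperators_gen_smul X hX j v)).mpr (hW j v hv))
  exact ⟨N, Submodule.ext hN⟩

theorem isSimpleModule_ofOperators [Nontrivial V]
    (h : ∀ W : Submodule K V, (∀ j, ∀ v ∈ W, X j v ∈ W) → W = ⊥ ∨ W = ⊤) :
    IsSimpleModule (CyclicAlgebra K k)ᵐᵒᵖ (ofOperators X hX) := by
  have : Nontrivial (ofOperators X hX) := inferInstanceAs (Nontrivial V)
  refine (isSimpleModule_iff _ _).mpr { eq_bot_or_eq_top := fun N => ?_ }
  refine (h (toSubspace X hX N) (toSubspace_invariant X hX N)).imp (fun h => ?_) fun h => ?_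
  · exact (Submodule.eq_bot_iff N).mpr fun v hv => (Submodule.eq_bot_iff _).mp h v hv
  · exact Submodule.eq_top_iff'.mpr fun v => Submodule.eq_top_iff'.mp h v

/-- Isomorphic modules have simultaneously conjugate operators. -/
theorem exists_conj_of_equiv {X Y : Fin n → Module.End K V} {hX : ∀ j, X j ^ k j = 1}
    {hY : ∀ j, Y j ^ k j = 1} (h : ofOperators X hX ≈ ofOperators Y hY) :
    ∃ e : V ≃ₗ[K] V, ∀ j, Y j = e.conj (X j) := by
  obtain ⟨φ⟩ := h
  let e : V ≃ₗ[K] V := φ.restrictScalars K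
  have he (j : Fin n) (v : V) : e (X j v) = Y j (e v) := by
    rw [← ofOperators_gen_smul X hX, ← ofOperators_gen_smul Y hY]
    exact φ.map_smul _ _
  refine ⟨e, fun j => LinearMap.ext fun v => ?_⟩
  rw [LinearEquiv.conj_apply_apply, he, LinearEquiv.apply_symm_apply]

end Operators

end FDRightModule

/-! ### The cyclic case -/

section Cyclic

variable {n : ℕ} (k : Fin n → ℕ)

theorem finite_and_isCyclic_of_subsingleton [Subsingleton (Fin n)] (hn : 1 ≤ n)
    (hk : ∀ j, k j ≠ 0) : Finite (CyclicFreeProduct k) ∧ IsCyclic (CyclicFreeProduct k) := by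
  let i : Fin n := ⟨0, hn⟩
  have : NeZero (k i) := ⟨hk i⟩
  let f : Multiplicative (ZMod (k i)) →* CyclicFreeProduct k :=
    Monoid.CoprodI.of (M := fun j => Multiplicative (ZMod (k j))) (i := i)
  have hf : Function.Surjective f := by
    intro x
    change x ∈ MonoidHom.range f
    induction x using Monoid.CoprodI.induction_on with
    | one => exact one_mem _
    | of j m =>
      obtain rfl : j = i := Subsingleton.elim _ _
      exact ⟨m, rfl⟩
    | mul x y hx hy => exact mul_mem hx hy
  have : Finite (Multiplicative (ZMod (k i))) := inferInstanceAs (Finite (ZMod (k i)))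
  exact ⟨Finite.of_surjective f hf, isCyclic_of_surjective f hf⟩

end Cyclic

namespace FDRightModule

variable {K : Type u} [Field K] {A : Type v} [Ring A] [Algebra K A]

/-- Over a semisimple algebra every simple module embeds in the regular module, and two of them
are isomorphic when they generate the same isotypic component, so there are finitely many. -/
theorem finite_simpleClasses_of_isSemisimpleRing [IsSemisimpleRing Aᵐᵒᵖ] :
    (simpleClasses K A).Finite := by
  have hsimple : ∀ q ∈ simpleClasses K A, IsSimpleModule Aᵐᵒᵖ q.out := by
    rintro _ ⟨M, hM, rfl⟩
    obtain ⟨e⟩ : (Quotient.mk (isoSetoid K A) M).out ≈ M := Quotient.mk_out M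
    exact IsSimpleModule.congr e
  refine Set.Finite.of_finite_image (f := fun q => isotypicComponent Aᵐᵒᵖ Aᵐᵒᵖ q.out)
    ((Set.toFinite (isotypicComponents Aᵐᵒᵖ Aᵐᵒᵖ)).subset ?_) ?_
  · rintro _ ⟨q, hq, rfl⟩
    have := hsimple q hq
    obtain ⟨I, ⟨e⟩⟩ :=
      IsSemisimpleRing.exists_linearEquiv_ideal_of_isSimpleModule Aᵐᵒᵖ q.out
    exact ⟨I, IsSimpleModule.congr e.symm, e.isotypicComponent_eq⟩
  · intro q hq r hr hqr
    have := hsimple q hq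
    have := hsimple r hr
    obtain ⟨I, ⟨e⟩⟩ :=
      IsSemisimpleRing.exists_linearEquiv_ideal_of_isSimpleModule Aᵐᵒᵖ q.out
    have hI : I ≤ isotypicComponent Aᵐᵒᵖ Aᵐᵒᵖ r.out := by
      have h1 := I.le_isotypicComponent
      rw [e.symm.isotypicComponent_eq] at h1
      exact h1.trans hqr.le
    have : IsSimpleModule Aᵐᵒᵖ I := IsSimpleModule.congr e.symm
    have hiso := IsIsotypicOfType.isotypicComponent (R := Aᵐᵒᵖ) (M := Aᵐᵒᵖ) (S := r.out)
    let J : Submodule Aᵐᵒᵖ (isotypicComponent Aᵐᵒᵖ Aᵐᵒᵖ r.out) :=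
      Submodule.comap (isotypicComponent Aᵐᵒᵖ Aᵐᵒᵖ r.out).subtype I
    let eJ : J ≃ₗ[Aᵐᵒᵖ] I := Submodule.comapSubtypeEquivOfLe hI
    have : IsSimpleModule Aᵐᵒᵖ J := IsSimpleModule.congr eJ
    obtain ⟨e'⟩ := hiso J
    rw [← q.out_eq, ← r.out_eq]
    exact Quotient.sound ⟨(e.trans eJ.symm).trans e'⟩

theorem isSemisimpleRing_op_of_finite [CharZero K] {G : Type*} [Group G] [Finite G]
    (e : A ≃ₐ[K] MonoidAlgebra K G) : IsSemisimpleRing Aᵐᵒᵖ := by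
  have : NeZero (Nat.card G : K) := ⟨Nat.cast_ne_zero.mpr Nat.card_pos.ne'⟩
  have : IsSemisimpleRing A := e.symm.toRingEquiv.isSemisimpleRing
  infer_instance

end FDRightModule

/-! ### Operators with few eigenvalues -/

section Stretch

variable {K : Type*} [Field K] {B : Type*} [Ring B] [Algebra K B]

/-- For an idempotent `e`, the element acting as `z` on the image of `e` and as the identity on
its kernel. -/
def stretch (z : K) (e : B) : B := 1 + (z - 1) • e

theorem stretch_mul_stretch {e : B} (he : e * e = e) (z w : K) :
    stretch z e * stretch w e = stretch (z * w) e := by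
  simp only [stretch, add_mul, mul_add, one_mul, mul_one, smul_mul_smul_comm, he]
  module

theorem stretch_pow {e : B} (he : e * e = e) (z : K) (m : ℕ) :
    stretch z e ^ m = stretch (z ^ m) e := by
  induction m with
  | zero => simp [stretch]
  | succ m ih => rw [pow_succ, ih, stretch_mul_stretch he, pow_succ]

theorem stretch_pow_eq_one {e : B} (he : e * e = e) {z : K} {m : ℕ} (hz : z ^ m = 1) :
    stretch z e ^ m = 1 := by
  rw [stretch_pow he, hz, stretch, sub_self, zero_smul, add_zero]

theorem stretch_mul_stretch_of_orthogonal {e f : B} (hef : e * f = 0) (z w : K) :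
    stretch z e * stretch w f = 1 + (z - 1) • e + (w - 1) • f := by
  simp only [stretch, add_mul, mul_add, one_mul, mul_one, smul_mul_smul_comm, hef]
  module

theorem stretch_mul_stretch_pow_eq_one {e f : B} (he : e * e = e) (hf : f * f = f)
    (hef : e * f = 0) (hfe : f * e = 0) {z w : K} {m : ℕ} (hz : z ^ m = 1) (hw : w ^ m = 1) :
    (stretch z e * stretch w f) ^ m = 1 := by
  have hc : Commute (stretch z e) (stretch w f) := by
    rw [Commute, SemiconjBy, stretch_mul_stretch_of_orthogonal hef,
      stretch_mul_stretch_of_orthogonal hfe]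
    abel
  rw [hc.mul_pow, stretch_pow_eq_one he hz, stretch_pow_eq_one hf hw, one_mul]

variable {V : Type*} [AddCommGroup V] [Module K V]

theorem mem_of_stretch_mem {W : Submodule K V} {e : Module.End K V} {z : K} (hz : z ≠ 1)
    (hW : ∀ v ∈ W, stretch z e v ∈ W) : ∀ v ∈ W, e v ∈ W := by
  intro v hv
  have h : (z - 1) • e v ∈ W := by
    have := W.sub_mem (hW v hv) hv
    simpa [stretch] using this
  exact (W.smul_mem_iff (sub_ne_zero.mpr hz)).mp h

/-- An operator with three distinct eigenvalues `1`, `z`, `w` determines its eigenprojections as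
polynomials in it; here the projection onto the `z`-eigenspace. -/
theorem mem_of_stretch_mul_stretch_mem {W : Submodule K V} {e f : Module.End K V}
    (he : e * e = e) (hf : f * f = f) (hef : e * f = 0) (hfe : f * e = 0) {z w : K}
    (hz : z ≠ 1) (hzw : z ≠ w)
    (hW : ∀ v ∈ W, (stretch z e * stretch w f) v ∈ W) : ∀ v ∈ W, e v ∈ W := by
  rw [stretch_mul_stretch_of_orthogonal hef] at hW
  intro v hv
  have he' : e (e v) = e v := LinearMap.congr_fun he v
  have hf' : f (f v) = f v := LinearMap.congr_fun hf v
  have hef' : e (f v) = 0 := LinearMap.congr_fun hef v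
  have hfe' : f (e v) = 0 := LinearMap.congr_fun hfe v
  -- Apply `(Y - 1) (Y - w)` for the operator `Y = 1 + (z - 1) e + (w - 1) f`.
  have h : ((z - 1) * (z - w)) • e v ∈ W := by
    have h1 := W.sub_mem (hW v hv) (W.smul_mem w hv)
    have h2 := W.sub_mem (hW _ h1) h1
    convert h2 using 1
    simp only [LinearMap.add_apply, LinearMap.smul_apply, Module.End.one_apply, map_add, map_sub,
      map_smul, he', hf', hef', hfe']
    module
  exact (W.smul_mem_iff (mul_ne_zero (sub_ne_zero.mpr hz) (sub_ne_zero.mpr hzw))).mp h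

end Stretch

theorem exists_isPrimitiveRoot_of_one_lt (K : Type*) [Field K] [IsAlgClosed K] [CharZero K]
    {m : ℕ} (hm : 1 < m) : ∃ z : K, IsPrimitiveRoot z m := by
  have : NeZero (m : K) := ⟨Nat.cast_ne_zero.mpr (by omega)⟩
  exact HasEnoughRootsOfUnity.exists_primitiveRoot K m

/-! ### Two-dimensional modules -/

section Pair

variable {K : Type*} [Field K] {V : Type*} [AddCommGroup V] [Module K V] {n : ℕ}

/-- The operators in which the `i`-th and the `j`-th are the given ones, and all others are the
identity. -/
def pairOperators (i j : Fin n) (X Y : Module.End K V) (l : Fin n) : Module.End K V :=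
  if l = i then X else if l = j then Y else 1

variable {i j : Fin n} {X Y : Module.End K V}

@[simp]
theorem pairOperators_left : pairOperators i j X Y i = X := if_pos rfl

theorem pairOperators_right (hij : i ≠ j) : pairOperators i j X Y j = Y := by
  rw [pairOperators, if_neg hij.symm, if_pos rfl]

theorem pairOperators_pow {k : Fin n → ℕ} (hX : X ^ k i = 1) (hY : Y ^ k j = 1) (l : Fin n) :
    pairOperators i j X Y l ^ k l = 1 := by
  rw [pairOperators]
  split_ifs with h h'
  · rw [h, hX]
  · rw [h', hY]
  · exact one_pow _

end Pair

section TwoDim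

variable {K : Type u} [Field K]

/-- The projection of the plane onto the first coordinate axis. -/
def axisProj (K : Type u) [Field K] : Module.End K (Fin 2 → K) :=
  Matrix.toLin' !![1, 0; 0, 0]

/-- A family of idempotent operators of rank one on the plane, indexed by the trace `a` of their
products with `axisProj`. -/
def obliqueProj (a : K) : Module.End K (Fin 2 → K) :=
  Matrix.toLin' !![a, 1; a * (1 - a), 1 - a]

theorem axisProj_apply (v : Fin 2 → K) : axisProj K v = ![v 0, 0] := by
  ext l
  fin_cases l <;> simp [axisProj, Matrix.mulVec, dotProduct]

theorem obliqueProj_apply (a : K) (v : Fin 2 → K) :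
    obliqueProj a v = ![a * v 0 + v 1, a * (1 - a) * v 0 + (1 - a) * v 1] := by
  ext l
  fin_cases l <;> simp [obliqueProj, Matrix.mulVec, dotProduct]

theorem axisProj_mul_self : axisProj K * axisProj K = axisProj K := by
  refine LinearMap.ext fun v => ?_
  simp [axisProj_apply]

theorem obliqueProj_mul_self (a : K) : obliqueProj a * obliqueProj a = obliqueProj a := by
  refine LinearMap.ext fun v => ?_
  ext l
  fin_cases l
  · simp [obliqueProj_apply]
    ring
  · simp [obliqueProj_apply]
    ring

theorem trace_axisProj_mul_obliqueProj (a : K) :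
    LinearMap.trace K _ (axisProj K * obliqueProj a) = a := by
  rw [axisProj, obliqueProj, Module.End.mul_eq_comp, ← Matrix.toLin'_mul, Matrix.trace_toLin'_eq]
  simp [Matrix.trace]

theorem invariant_axisProj_obliqueProj {a : K} (h0 : a ≠ 0) (h1 : a ≠ 1)
    (W : Submodule K (Fin 2 → K)) (he : ∀ v ∈ W, axisProj K v ∈ W)
    (hf : ∀ v ∈ W, obliqueProj a v ∈ W) : W = ⊥ ∨ W = ⊤ := by
  refine or_iff_not_imp_left.mpr fun hW => ?_
  have split (v) (hv : v ∈ W) : ![v 0, 0] ∈ W ∧ ![0, v 1] ∈ W := by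
    have h := he v hv
    rw [axisProj_apply] at h
    refine ⟨h, ?_⟩
    convert W.sub_mem hv h using 1
    ext l
    fin_cases l <;> simp
  have scale0 (c : K) (hc : c ≠ 0) (h : ![c, 0] ∈ W) : ![1, 0] ∈ W := by
    convert W.smul_mem c⁻¹ h using 1
    simp [hc]
  have scale1 (c : K) (hc : c ≠ 0) (h : ![0, c] ∈ W) : ![0, 1] ∈ W := by
    convert W.smul_mem c⁻¹ h using 1
    simp [hc]
  have h01 (h : ![1, 0] ∈ W) : ![0, 1] ∈ W := by
    have h2 := (split _ (hf _ h)).2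
    exact scale1 (a * (1 - a)) (mul_ne_zero h0 (sub_ne_zero.mpr h1.symm))
      (by simpa [obliqueProj_apply] using h2)
  have h10 (h : ![0, 1] ∈ W) : ![1, 0] ∈ W := by
    have h2 := (split _ (hf _ h)).1
    exact scale0 1 one_ne_zero (by simpa [obliqueProj_apply] using h2)
  obtain ⟨v, hv, hv0⟩ := W.ne_bot_iff.mp hW
  have both : ![1, 0] ∈ W ∧ ![0, 1] ∈ W := by
    by_cases hv1 : v 0 = 0
    · have hv2 : v 1 ≠ 0 := fun h => hv0 (by ext l; fin_cases l <;> simp [hv1, h])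
      have := scale1 _ hv2 (split v hv).2
      exact ⟨h10 this, this⟩
    · have := scale0 _ hv1 (split v hv).1
      exact ⟨this, h01 this⟩
  refine Submodule.eq_top_iff'.mpr fun w => ?_
  convert W.add_mem (W.smul_mem (w 0) both.1) (W.smul_mem (w 1) both.2) using 1
  ext l
  fin_cases l <;> simp

end TwoDim

namespace FDRightModule

section

variable {K : Type u} [Field K] {n : ℕ} {k : Fin n → ℕ} {i j : Fin n} {z w : K}

theorem pairOperators_stretch_pow (hz : z ^ k i = 1) (hw : w ^ k j = 1) (a : K) (l : Fin n) :
    pairOperators i j (stretch z (axisProj K)) (stretch w (obliqueProj a)) l ^ k l = 1 :=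
  pairOperators_pow (stretch_pow_eq_one axisProj_mul_self hz)
    (stretch_pow_eq_one (obliqueProj_mul_self a) hw) l

/-- The two-dimensional module on which `x_i` and `x_j` have the eigenvalues `1, z` and `1, w`,
with eigenlines in a relative position given by `a`, and the other generators act trivially. -/
def twoDim (hz : z ^ k i = 1) (hw : w ^ k j = 1) (a : K) : FDRightModule K (CyclicAlgebra K k) :=
  ofOperators _ (pairOperators_stretch_pow hz hw a)

variable (hz : z ^ k i = 1) (hw : w ^ k j = 1)

theorem isSimpleModule_twoDim (hij : i ≠ j) (hz1 : z ≠ 1) (hw1 : w ≠ 1) {a : K} (h0 : a ≠ 0)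
    (h1 : a ≠ 1) : IsSimpleModule (CyclicAlgebra K k)ᵐᵒᵖ (twoDim hz hw a) := by
  refine isSimpleModule_ofOperators _ _ fun W hW => ?_
  refine invariant_axisProj_obliqueProj h0 h1 W (mem_of_stretch_mem hz1 ?_)
    (mem_of_stretch_mem hw1 ?_)
  · simpa using hW i
  · simpa [pairOperators_right hij] using hW j

theorem twoDim_injective (hij : i ≠ j) (hz1 : z ≠ 1) (hw1 : w ≠ 1) {a b : K}
    (h : twoDim hz hw a ≈ twoDim hz hw b) : a = b := by
  obtain ⟨φ, hφ⟩ := exists_conj_of_equiv h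
  have conj_stretch {z : K} (hz1 : z ≠ 1) {e f : Module.End K (Fin 2 → K)}
      (h : stretch z f = φ.conj (stretch z e)) : f = φ.conj e := by
    have h1 : φ.conj 1 = 1 := φ.conj_id
    rw [stretch, stretch, map_add, map_smul, h1, add_right_inj] at h
    exact smul_right_injective _ (sub_ne_zero.mpr hz1) h
  have he := conj_stretch hz1 (by simpa using hφ i)
  have hf := conj_stretch hw1 (by simpa [pairOperators_right hij] using hφ j)
  rw [← trace_axisProj_mul_obliqueProj a, ← trace_axisProj_mul_obliqueProj b]
  nth_rw 2 [he]
  rw [hf, Module.End.mul_eq_comp, Module.End.mul_eq_comp, ← LinearEquiv.conj_comp,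
    LinearMap.trace_conj']

theorem not_isSemisimpleCat (hz : z ^ k i = 1) (hw : w ^ k j = 1) (hij : i ≠ j)
    (hz1 : z ≠ 1) (hw1 : w ≠ 1) : ¬ IsSemisimpleCat K (CyclicAlgebra K k) := by
  intro hss
  have := hss (ofOperators _ (pairOperators_stretch_pow hz hw 0))
  -- The first axis is preserved, but the only complement preserved by `axisProj` is the second
  -- axis, and `obliqueProj 0` does not preserve it.
  let W : Submodule K (Fin 2 → K) := LinearMap.ker (LinearMap.proj 1)
  have hW (v : Fin 2 → K) : v ∈ W ↔ v 1 = 0 := Iff.rfl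
  obtain ⟨N, hN⟩ := exists_submodule_ofOperators _ (pairOperators_stretch_pow hz hw 0) W (by
    intro l v hv
    rw [hW] at hv ⊢
    rw [pairOperators]
    split_ifs <;> simp [stretch, axisProj_apply, obliqueProj_apply, hv])
  have hNW (v : Fin 2 → K) :
      (show ofOperators _ (pairOperators_stretch_pow hz hw 0) from v) ∈ N ↔ v ∈ W := by
    rw [← hN]
    rfl
  obtain ⟨N', hNN'⟩ := exists_isCompl N
  have hinv := toSubspace_invariant _ (pairOperators_stretch_pow hz hw 0) N'
  have he := mem_of_stretch_mem hz1 (by simpa using hinv i)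
  have hf := mem_of_stretch_mem hw1 (by simpa [pairOperators_right hij] using hinv j)
  set W' := toSubspace _ (pairOperators_stretch_pow hz hw 0) N'
  have hdisj (v : Fin 2 → K) (hv : v ∈ W) (hv' : v ∈ W') : v = 0 :=
    (Submodule.disjoint_def.mp hNN'.disjoint) v ((hNW v).mpr hv) hv'
  obtain ⟨p, hp, q, hq, hpq⟩ := Submodule.mem_sup.mp
    (hNN'.sup_eq_top ▸ Submodule.mem_top : 
      (show ofOperators _ (pairOperators_stretch_pow hz hw 0) from ![0, 1]) ∈ N ⊔ N')
  change Fin 2 → K at p q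
  have hq' : q ∈ W' := hq
  have hq1 : q 1 = 1 := by
    have h := congrFun hpq 1
    have hp' : p 1 = 0 := (hNW p).mp hp
    change p 1 + q 1 = 1 at h
    rwa [hp', zero_add] at h
  have h01 : ![0, 1] ∈ W' := by
    convert W'.sub_mem hq' (he q hq') using 1
    rw [axisProj_apply]
    ext l
    fin_cases l <;> simp [hq1]
  have h10 : ![1, 0] ∈ W' := by
    convert he _ (hf _ h01) using 1
    simp [axisProj_apply, obliqueProj_apply]
  have := congrFun (hdisj _ (by simp [hW]) h10) 0
  simp at this

end

variable {K : Type u} [Field K] [IsAlgClosed K] [CharZero K] {n : ℕ} {k : Fin n → ℕ}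

theorem infinite_simpleClasses (hk : ∀ j, 1 < k j) (hn : 2 ≤ n) :
    (simpleClasses K (CyclicAlgebra K k)).Infinite := by
  let i : Fin n := ⟨0, by omega⟩
  let j : Fin n := ⟨1, by omega⟩
  have hij : i ≠ j := by simp [i, j]
  obtain ⟨z, hz⟩ := exists_isPrimitiveRoot_of_one_lt K (hk i)
  obtain ⟨w, hw⟩ := exists_isPrimitiveRoot_of_one_lt K (hk j)
  have hinf : ({0, 1}ᶜ : Set K).Infinite := (Set.toFinite _).infinite_compl
  refine Set.infinite_of_injOn_mapsTo
    (f := fun a => Quotient.mk _ (twoDim hz.pow_eq_one hw.pow_eq_one a))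
    (fun a _ b _ hab => ?_) (fun a ha => ?_) hinf
  · exact twoDim_injective _ _ hij (hz.ne_one (hk i)) (hw.ne_one (hk j)) (Quotient.exact hab)
  · simp only [Set.mem_compl_iff, Set.mem_insert_iff, Set.mem_singleton_iff, not_or] at ha
    exact ⟨_, isSimpleModule_twoDim _ _ hij (hz.ne_one (hk i)) (hw.ne_one (hk j)) ha.1 ha.2, rfl⟩

theorem eq_one_of_isSemisimpleCat (hk : ∀ j, 1 < k j) (hn : 1 ≤ n)
    (h : IsSemisimpleCat K (CyclicAlgebra K k)) : n = 1 := by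
  by_contra hn1
  let i : Fin n := ⟨0, by omega⟩
  let j : Fin n := ⟨1, by omega⟩
  have hij : i ≠ j := by simp [i, j]
  obtain ⟨z, hz⟩ := exists_isPrimitiveRoot_of_one_lt K (hk i)
  obtain ⟨w, hw⟩ := exists_isPrimitiveRoot_of_one_lt K (hk j)
  exact not_isSemisimpleCat hz.pow_eq_one hw.pow_eq_one hij (hz.ne_one (hk i))
    (hw.ne_one (hk j)) h

end FDRightModule

/-! ### Irreducible triples of idempotents in large dimension -/

section Triple

variable {K : Type u} [Field K] {U : Type u} [AddCommGroup U] [Module K U]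

/-- The second coordinate projection of `U × U × U`, as an operator. -/
def sndProj (K U : Type u) [Field K] [AddCommGroup U] [Module K U] :
    Module.End K (U × U × U) where
  toFun x := (0, x.2.1, 0)
  map_add' x y := by simp
  map_smul' c x := by simp

/-- The third coordinate projection of `U × U × U`, as an operator. -/
def thdProj (K U : Type u) [Field K] [AddCommGroup U] [Module K U] :
    Module.End K (U × U × U) where
  toFun x := (0, 0, x.2.2)
  map_add' x y := by simp
  map_smul' c x := by simp

/-- The idempotent operator on `U × U × U` that is the product of the column `(1, A, B)` with the
row `(1 - A - B, 1, 1)`; it is idempotent because the row times the column is `1`. -/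
def columnRowProj (A B : Module.End K U) : Module.End K (U × U × U) :=
  (LinearMap.id.prod (A.prod B)).comp
    ((1 - A - B).coprod (LinearMap.id.coprod LinearMap.id))

theorem columnRowProj_apply (A B : Module.End K U) (x y z : U) :
    columnRowProj A B (x, y, z) =
      ((1 - A - B) x + (y + z), A ((1 - A - B) x + (y + z)), B ((1 - A - B) x + (y + z))) :=
  rfl

theorem sndProj_mul_self : sndProj K U * sndProj K U = sndProj K U := rfl

theorem thdProj_mul_self : thdProj K U * thdProj K U = thdProj K U := rfl

theorem sndProj_mul_thdProj : sndProj K U * thdProj K U = 0 := rfl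

theorem thdProj_mul_sndProj : thdProj K U * sndProj K U = 0 := rfl

theorem columnRowProj_mul_self (A B : Module.End K U) :
    columnRowProj A B * columnRowProj A B = columnRowProj A B := by
  refine LinearMap.ext fun ⟨x, y, z⟩ => ?_
  rw [Module.End.mul_apply, columnRowProj_apply, columnRowProj_apply]
  have h (s : U) : (1 - A - B) s + (A s + B s) = s := by
    simp only [LinearMap.sub_apply, Module.End.one_apply]
    abel
  rw [h]

/-- An irreducible pair of operators `A`, `A * B` on `U` yields an irreducible triple of
idempotents on `U × U × U`, two of which are orthogonal. -/
theorem invariant_triple {A B : Module.End K U} (hA : Function.Injective A)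
    (hB : Function.Surjective B) (hC : Function.Injective (1 - A - B : Module.End K U))
    (hAB : ∀ T : Submodule K U, (∀ v ∈ T, A v ∈ T) → (∀ v ∈ T, A (B v) ∈ T) → T = ⊥ ∨ T = ⊤)
    (W : Submodule K (U × U × U)) (he : ∀ v ∈ W, columnRowProj A B v ∈ W)
    (hf : ∀ v ∈ W, sndProj K U v ∈ W) (hg : ∀ v ∈ W, thdProj K U v ∈ W) : W = ⊥ ∨ W = ⊤ := by
  let T : Submodule K U :=
    W.comap (LinearMap.inr K U (U × U) ∘ₗ LinearMap.inl K U U)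
  have mem_T (y : U) : y ∈ T ↔ ((0, y, 0) : U × U × U) ∈ W := Iff.rfl
  have col_of_snd {y : U} (h : ((0, y, 0) : U × U × U) ∈ W) : (y, A y, B y) ∈ W := by
    simpa [columnRowProj_apply] using he _ h
  have col_of_thd {z : U} (h : ((0, 0, z) : U × U × U) ∈ W) : (z, A z, B z) ∈ W := by
    simpa [columnRowProj_apply] using he _ h
  refine (hAB T (fun y hy => ?_) fun y hy => ?_).imp (fun hT => ?_) fun hT => ?_
  · exact hf _ (col_of_snd hy)
  · exact hf _ (col_of_thd (hg _ (col_of_snd hy)))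
  · have snd_zero {y : U} (h : ((0, y, 0) : U × U × U) ∈ W) : y = 0 := by
      rwa [← mem_T, hT, Submodule.mem_bot] at h
    rw [Submodule.eq_bot_iff]
    rintro ⟨x, y, z⟩ hv
    obtain rfl : y = 0 := snd_zero (hf _ hv)
    obtain rfl : z = 0 :=
      (map_eq_zero_iff A hA).mp (snd_zero (hf _ (col_of_thd (hg _ hv))))
    have hx : A ((1 - A - B) x + (0 + 0)) = 0 := snd_zero (hf _ (he _ hv))
    rw [add_zero, add_zero] at hx
    obtain rfl : x = 0 := (map_eq_zero_iff _ hC).mp ((map_eq_zero_iff A hA).mp hx)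
    rfl
  · have hy (y : U) : ((0, y, 0) : U × U × U) ∈ W := by
      rw [← mem_T, hT]
      exact Submodule.mem_top
    have hz (z : U) : ((0, 0, z) : U × U × U) ∈ W := by
      obtain ⟨y, rfl⟩ := hB z
      exact hg _ (col_of_snd (hy y))
    have hx (x : U) : ((x, 0, 0) : U × U × U) ∈ W := by
      have := W.sub_mem (W.sub_mem (col_of_snd (hy x)) (hy (A x))) (hz (B x))
      simpa [← Prod.zero_eq_mk] using this
    refine Submodule.eq_top_iff'.mpr fun ⟨x, y, z⟩ => ?_
    have := W.add_mem (W.add_mem (hx x) (hy y)) (hz z)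
    simpa using this

end Triple

section Diagonal

variable {K : Type u} [Field K]

/-- A subspace preserved by a diagonal operator with distinct eigenvalues contains the coordinate
components of its vectors. -/
theorem single_mem_of_mul_mem {ι : Type*} [Fintype ι] [DecidableEq ι] {a : ι → K}
    (ha : Function.Injective a) {T : Submodule K (ι → K)} (hT : ∀ v ∈ T, a * v ∈ T)
    {v : ι → K} (hv : v ∈ T) (i : ι) : Pi.single i (v i) ∈ T := by
  -- Kill the other components with `∏ j ≠ i, (a - a j)`.
  have hprod (s : Finset ι) : (fun l => (∏ j ∈ s, (a l - a j)) * v l) ∈ T := by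
    induction s using Finset.induction_on with
    | empty => simpa using hv
    | insert j s hj ih =>
      convert T.sub_mem (hT _ ih) (T.smul_mem (a j) ih) using 1
      funext l
      simp only [Finset.prod_insert hj, Pi.sub_apply, Pi.mul_apply, Pi.smul_apply, smul_eq_mul]
      ring
  have hc : ∏ j ∈ Finset.univ.erase i, (a i - a j) ≠ 0 :=
    Finset.prod_ne_zero_iff.mpr fun j hj =>
      sub_ne_zero.mpr fun h => Finset.ne_of_mem_erase hj (ha h).symm
  rw [← T.smul_mem_iff hc]
  convert hprod (Finset.univ.erase i) using 1
  funext l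
  by_cases hl : l = i
  · subst hl
    simp
  · rw [Pi.smul_apply, Pi.single_eq_of_ne hl, smul_zero,
      Finset.prod_eq_zero (Finset.mem_erase.mpr ⟨hl, Finset.mem_univ l⟩) (sub_self (a l)),
      zero_mul]

/-- The diagonal operator with eigenvalues `1, 2, …, d`. -/
def rampMul (K : Type u) [Field K] (d : ℕ) : Module.End K (Fin d → K) :=
  LinearMap.mulLeft K fun i : Fin d => ((i : ℕ) + 1 : K)

/-- The linear form `v ↦ ∑ i, (i + 1) v_i`. Its coefficients are the eigenvalues of `rampMul`,
which makes both `1 + u φ` and `-rampMul - u φ` invertible, for `u` the vector of ones. -/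
def rampForm (K : Type u) [Field K] (d : ℕ) : (Fin d → K) →ₗ[K] K :=
  ∑ i : Fin d, ((i : ℕ) + 1 : K) • LinearMap.proj i

/-- The perturbation of the identity by an operator of rank one that mixes all coordinates. -/
def rampShear (K : Type u) [Field K] (d : ℕ) : Module.End K (Fin d → K) :=
  1 + (rampForm K d).smulRight 1

variable {d : ℕ}

theorem rampMul_apply (v : Fin d → K) :
    rampMul K d v = (fun i : Fin d => ((i : ℕ) + 1 : K)) * v := rfl

theorem rampForm_apply (v : Fin d → K) : rampForm K d v = ∑ i : Fin d, ((i : ℕ) + 1 : K) * v i := by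
  simp [rampForm]

theorem rampShear_apply (v : Fin d → K) : rampShear K d v = v + rampForm K d v • 1 := rfl

variable [CharZero K]

theorem rampMul_injective : Function.Injective (rampMul K d) := by
  refine (injective_iff_map_eq_zero _).mpr fun v hv => ?_
  funext i
  have h : ((i : ℕ) + 1 : K) * v i = 0 := congrFun hv i
  exact (mul_eq_zero.mp h).resolve_left (Nat.cast_add_one_ne_zero _)

theorem rampShear_injective : Function.Injective (rampShear K d) := by
  refine (injective_iff_map_eq_zero _).mpr fun v hv => ?_
  rw [rampShear_apply] at hv
  have hvi (i : Fin d) : v i = -rampForm K d v := by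
    have := congrFun hv i
    simpa [add_eq_zero_iff_eq_neg] using this
  have hs : rampForm K d v = 0 := by
    have h := rampForm_apply v
    simp_rw [hvi] at h
    rw [← Finset.sum_mul] at h
    have hne : (∑ i : Fin d, ((i : ℕ) + 1 : K)) + 1 ≠ 0 := by
      have : (((∑ i : Fin d, ((i : ℕ) + 1)) + 1 : ℕ) : K) ≠ 0 :=
        Nat.cast_ne_zero.mpr (Nat.succ_ne_zero _)
      push_cast at this
      exact this
    refine (mul_eq_zero.mp (?_ : _ * rampForm K d v = 0)).resolve_left hne
    linear_combination h
  funext i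
  rw [hvi, hs, neg_zero, Pi.zero_apply]

theorem one_sub_rampMul_sub_rampShear_injective :
    Function.Injective (1 - rampMul K d - rampShear K d : Module.End K (Fin d → K)) := by
  refine (injective_iff_map_eq_zero _).mpr fun v hv => ?_
  have hvi (i : Fin d) : ((i : ℕ) + 1 : K) * v i = -rampForm K d v := by
    have h := congrFun hv i
    simp only [LinearMap.sub_apply, Module.End.one_apply, rampMul_apply, rampShear_apply,
      Pi.sub_apply, Pi.mul_apply, Pi.add_apply, Pi.smul_apply, Pi.one_apply, Pi.zero_apply,
      smul_eq_mul] at h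
    linear_combination -h
  have hs : rampForm K d v = 0 := by
    have h := rampForm_apply v
    simp_rw [hvi] at h
    rw [Finset.sum_const, Finset.card_univ, Fintype.card_fin, nsmul_eq_mul] at h
    refine (mul_eq_zero.mp (?_ : ((d : K) + 1) * rampForm K d v = 0)).resolve_left
      (Nat.cast_add_one_ne_zero d)
    linear_combination h
  funext i
  have h := hvi i
  rw [hs, neg_zero] at h
  exact (mul_eq_zero.mp h).resolve_left (Nat.cast_add_one_ne_zero _)

theorem invariant_rampMul_rampShear (T : Submodule K (Fin d → K))
    (hA : ∀ v ∈ T, rampMul K d v ∈ T) (hAB : ∀ v ∈ T, rampMul K d (rampShear K d v) ∈ T) :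
    T = ⊥ ∨ T = ⊤ := by
  have hinj : Function.Injective fun i : Fin d => ((i : ℕ) + 1 : K) := fun i j h =>
    Fin.ext (Nat.cast_injective (add_right_cancel h))
  have hne (i : Fin d) : ((i : ℕ) + 1 : K) ≠ 0 := Nat.cast_add_one_ne_zero _
  refine or_iff_not_imp_left.mpr fun hT => ?_
  obtain ⟨v, hv, hv0⟩ := T.ne_bot_iff.mp hT
  obtain ⟨i, hi⟩ := Function.ne_iff.mp hv0
  have normalize {j : Fin d} {c : K} (hc : c ≠ 0) (h : Pi.single j c ∈ T) :
      (Pi.single j 1 : Fin d → K) ∈ T := by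
    have := T.smul_mem c⁻¹ h
    rwa [← Pi.single_smul, smul_eq_mul, inv_mul_cancel₀ hc] at this
  have hei := normalize hi (single_mem_of_mul_mem hinj hA hv i)
  have hramp : (fun i : Fin d => ((i : ℕ) + 1 : K)) ∈ T := by
    have h1 := T.sub_mem (hAB _ hei) (hA _ hei)
    have hφ : rampForm K d (Pi.single i 1) = ((i : ℕ) + 1 : K) := by
      simp [rampForm_apply, Pi.single_apply]
    rw [rampShear_apply, hφ, map_add, add_sub_cancel_left, map_smul,
      T.smul_mem_iff (hne i), rampMul_apply, mul_one] at h1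
    exact h1
  have hej (j : Fin d) : (Pi.single j 1 : Fin d → K) ∈ T :=
    normalize (hne j) (single_mem_of_mul_mem hinj hA hramp j)
  refine Submodule.eq_top_iff'.mpr fun w => ?_
  rw [pi_eq_sum_univ' w]
  exact T.sum_mem fun j _ => T.smul_mem _ (hej j)

/-- In dimension `3 d` there are three idempotents, two of them orthogonal, without a common
invariant subspace other than zero and the whole space. -/
theorem exists_irreducible_triple (K : Type u) [Field K] [CharZero K] (d : ℕ) :
    ∃ e f g : Module.End K ((Fin d → K) × (Fin d → K) × (Fin d → K)),
      e * e = e ∧ f * f = f ∧ g * g = g ∧ f * g = 0 ∧ g * f = 0 ∧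
      ∀ W : Submodule K ((Fin d → K) × (Fin d → K) × (Fin d → K)), (∀ v ∈ W, e v ∈ W) →
        (∀ v ∈ W, f v ∈ W) → (∀ v ∈ W, g v ∈ W) → W = ⊥ ∨ W = ⊤ :=
  ⟨columnRowProj (rampMul K d) (rampShear K d), sndProj K _, thdProj K _,
    columnRowProj_mul_self _ _, sndProj_mul_self, thdProj_mul_self, sndProj_mul_thdProj,
    thdProj_mul_sndProj,
    invariant_triple rampMul_injective
      (LinearMap.injective_iff_surjective.mp rampShear_injective)
      one_sub_rampMul_sub_rampShear_injective invariant_rampMul_rampShear⟩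

end Diagonal

namespace FDRightModule

variable {K : Type u} [Field K] [IsAlgClosed K] [CharZero K] {n : ℕ} {k : Fin n → ℕ}

/-- A generator of order at least three realizes two orthogonal idempotents as polynomials in
one operator. -/
theorem exists_simple_of_two_lt (hk : ∀ j, 1 < k j) {i j : Fin n} (hij : i ≠ j) (hj : 2 < k j)
    (d : ℕ) :
    ∃ M : FDRightModule K (CyclicAlgebra K k), IsSimpleModule (CyclicAlgebra K k)ᵐᵒᵖ M ∧
      d < Module.finrank K M := by
  obtain ⟨z, hz⟩ := exists_isPrimitiveRoot_of_one_lt K (hk i)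
  obtain ⟨w, hw⟩ := exists_isPrimitiveRoot_of_one_lt K (hk j)
  obtain ⟨e, f, g, he, hf, hg, hfg, hgf, hirr⟩ := exists_irreducible_triple K (d + 1)
  have hw1 : w ≠ 1 := hw.ne_one (hk j)
  have hw2 : w ^ 2 ≠ 1 := hw.pow_ne_one_of_pos_of_lt two_ne_zero hj
  have hww : w ≠ w ^ 2 := fun h => hw1 (mul_left_cancel₀ (hw.ne_zero (by omega))
    (by rw [mul_one, ← pow_two, ← h]))
  have hgfs : stretch w f * stretch (w ^ 2) g = stretch (w ^ 2) g * stretch w f := by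
    rw [stretch_mul_stretch_of_orthogonal hfg, stretch_mul_stretch_of_orthogonal hgf]
    abel
  have hpow := pairOperators_pow (k := k) (i := i) (j := j)
    (stretch_pow_eq_one he hz.pow_eq_one)
    (stretch_mul_stretch_pow_eq_one hf hg hfg hgf hw.pow_eq_one
      (w := w ^ 2) (by rw [← pow_mul, mul_comm, pow_mul, hw.pow_eq_one, one_pow]))
  refine ⟨ofOperators _ hpow, isSimpleModule_ofOperators _ _ fun W hW => ?_, ?_⟩
  · have hWj := hW j
    rw [pairOperators_right hij] at hWj
    refine hirr W (mem_of_stretch_mem (hz.ne_one (hk i)) (by simpa using hW i))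
      (mem_of_stretch_mul_stretch_mem hf hg hfg hgf hw1 hww hWj)
      (mem_of_stretch_mul_stretch_mem hg hf hgf hfg hw2 hww.symm (hgfs ▸ hWj))
  · change d < Module.finrank K ((Fin (d + 1) → K) × (Fin (d + 1) → K) × (Fin (d + 1) → K))
    simp only [Module.finrank_prod, Module.finrank_fin_fun]
    omega

theorem exists_simple_of_three (hk : ∀ j, 1 < k j) (hn : 3 ≤ n) (d : ℕ) :
    ∃ M : FDRightModule K (CyclicAlgebra K k), IsSimpleModule (CyclicAlgebra K k)ᵐᵒᵖ M ∧
      d < Module.finrank K M := by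
  obtain ⟨e, f, g, he, hf, hg, -, -, hirr⟩ := exists_irreducible_triple K (d + 1)
  choose z hz using fun j => exists_isPrimitiveRoot_of_one_lt K (hk j)
  let p (j : Fin n) : Module.End K ((Fin (d + 1) → K) × (Fin (d + 1) → K) × (Fin (d + 1) → K)) :=
    if (j : ℕ) = 0 then e else if (j : ℕ) = 1 then f else g
  have hp (j : Fin n) : p j * p j = p j := by
    simp only [p]
    split_ifs <;> assumption
  refine ⟨ofOperators (fun j => stretch (z j) (p j))
    fun j => stretch_pow_eq_one (hp j) (hz j).pow_eq_one,
    isSimpleModule_ofOperators _ _ fun W hW => ?_, ?_⟩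
  · have hWp (j : Fin n) := mem_of_stretch_mem ((hz j).ne_one (hk j)) (hW j)
    exact hirr W (hWp ⟨0, by omega⟩) (hWp ⟨1, by omega⟩) (hWp ⟨2, by omega⟩)
  · change d < Module.finrank K ((Fin (d + 1) → K) × (Fin (d + 1) → K) × (Fin (d + 1) → K))
    simp only [Module.finrank_prod, Module.finrank_fin_fun]
    omega

theorem eq_two_of_hasBoundedSimples (hk : ∀ j, 1 < k j) (hn : 2 ≤ n)
    (h : HasBoundedSimples K (CyclicAlgebra K k)) : n = 2 ∧ ∀ j, k j = 2 := by
  obtain ⟨d, hd⟩ := h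
  have hno : ¬ ∃ M : FDRightModule K (CyclicAlgebra K k),
      IsSimpleModule (CyclicAlgebra K k)ᵐᵒᵖ M ∧ d < Module.finrank K M :=
    fun ⟨M, hM, hlt⟩ => (hd M hM).not_gt hlt
  constructor
  · by_contra hn2
    exact hno (exists_simple_of_three hk (by omega) d)
  · intro j
    by_contra hj
    have : Nontrivial (Fin n) := Fin.nontrivial_iff_two_le.mpr hn
    obtain ⟨i, hij⟩ := exists_ne j
    exact hno (exists_simple_of_two_lt hk hij (by have := hk j; omega) d)

end FDRightModule

/-! ### The infinite dihedral group -/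

namespace FDRightModule

open MulOpposite

variable {K : Type u} [Field K] [IsAlgClosed K] {A : Type v} [Ring A] [Algebra K A]

/-- If `A` is generated by two involutions `s` and `t`, then `s * t + t * s` is central and acts
on a simple module as a scalar. Then an eigenvector `v` of `s` and its image under `t` span the
module. -/
theorem finrank_le_two_of_involutions {s t : A} (hs : s * s = 1) (ht : t * t = 1)
    (hgen : Algebra.adjoin K {s, t} = ⊤) (M : FDRightModule K A)
    (hM : IsSimpleModule Aᵐᵒᵖ M) : Module.finrank K M ≤ 2 := by
  have : Nontrivial M := IsSimpleModule.nontrivial Aᵐᵒᵖ M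
  let S : Module.End K M := Module.toModuleEnd K (S := Aᵐᵒᵖ) M (op s)
  let T : Module.End K M := Module.toModuleEnd K (S := Aᵐᵒᵖ) M (op t)
  have hS (v : M) : op s • v = S v := rfl
  have hT (v : M) : op t • v = T v := rfl
  have hSS (v : M) : S (S v) = v := by
    rw [← hS, ← hS, smul_smul, ← op_mul, hs, op_one, one_smul]
  have hTT (v : M) : T (T v) = v := by
    rw [← hT, ← hT, smul_smul, ← op_mul, ht, op_one, one_smul]
  have full (W : Submodule K M) (hWS : ∀ w ∈ W, S w ∈ W) (hWT : ∀ w ∈ W, T w ∈ W)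
      (hne : W ≠ ⊥) : W = ⊤ := by
    refine M.eq_top_of_adjoin_eq_top hM hgen W ?_ hne
    rintro a (rfl | rfl)
    exacts [hWS, hWT]
  -- The central element acts as the scalar `c`.
  obtain ⟨c, hc⟩ := Module.End.exists_eigenvalue (S * T + T * S)
  have hcW : Module.End.eigenspace (S * T + T * S) c = ⊤ := by
    refine full _ (fun w hw => ?_) (fun w hw => ?_) hc
    · rw [Module.End.mem_eigenspace_iff] at hw ⊢
      have h := congrArg S hw
      simp only [LinearMap.add_apply, Module.End.mul_apply, map_add, map_smul, hSS] at h ⊢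
      rw [add_comm, h]
    · rw [Module.End.mem_eigenspace_iff] at hw ⊢
      have h := congrArg T hw
      simp only [LinearMap.add_apply, Module.End.mul_apply, map_add, map_smul, hTT] at h ⊢
      rw [add_comm, h]
  obtain ⟨μ, hμ⟩ := Module.End.exists_eigenvalue S
  obtain ⟨v, hv⟩ := hμ.exists_hasEigenvector
  have hSv : S v = μ • v := hv.apply_eq_smul
  have hSTv : S (T v) = c • v - μ • T v := by
    have h : v ∈ Module.End.eigenspace (S * T + T * S) c := hcW ▸ Submodule.mem_top
    rw [Module.End.mem_eigenspace_iff, LinearMap.add_apply, Module.End.mul_apply,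
      Module.End.mul_apply, hSv, map_smul] at h
    rw [← h, add_sub_cancel_right]
  have hspan : Submodule.span K {v, T v} = ⊤ := by
    have hv1 : v ∈ Submodule.span K {v, T v} := Submodule.subset_span (by simp)
    have hv2 : T v ∈ Submodule.span K {v, T v} := Submodule.subset_span (by simp)
    refine full _ (fun w hw => ?_) (fun w hw => ?_)
      (Submodule.ne_bot_iff _ |>.mpr ⟨v, hv1, hv.2⟩)
    · obtain ⟨a, b, rfl⟩ := Submodule.mem_span_pair.mp hw
      rw [map_add, map_smul, map_smul, hSv, hSTv]
      exact Submodule.add_mem _ (Submodule.smul_mem _ _ (Submodule.smul_mem _ _ hv1))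
        (Submodule.smul_mem _ _ (Submodule.sub_mem _ (Submodule.smul_mem _ _ hv1)
          (Submodule.smul_mem _ _ hv2)))
    · obtain ⟨a, b, rfl⟩ := Submodule.mem_span_pair.mp hw
      rw [map_add, map_smul, map_smul, hTT]
      exact Submodule.add_mem _ (Submodule.smul_mem _ _ hv2) (Submodule.smul_mem _ _ hv1)
  classical
  have hcard := finrank_span_finset_le_card (R := K) ({v, T v} : Finset M)
  rw [Finset.coe_insert, Finset.coe_singleton, Set.finrank, hspan, finrank_top] at hcard
  exact hcard.trans Finset.card_le_two

theorem hasBoundedSimples_of_dihedral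
    (e : A ≃ₐ[K] MonoidAlgebra K
      (Monoid.Coprod (Multiplicative (ZMod 2)) (Multiplicative (ZMod 2)))) :
    HasBoundedSimples K A := by
  let ρ : Monoid.Coprod (Multiplicative (ZMod 2)) (Multiplicative (ZMod 2)) →* A :=
    (e.symm : _ →* A).comp (MonoidAlgebra.of K _)
  have hinv : (.ofAdd 1 : Multiplicative (ZMod 2)) * .ofAdd 1 = 1 := rfl
  refine ⟨2, finrank_le_two_of_involutions (s := ρ (.inl (.ofAdd 1)))
    (t := ρ (.inr (.ofAdd 1))) ?_ ?_ ?_⟩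
  · rw [← map_mul, ← map_mul, hinv, map_one, map_one]
  · rw [← map_mul, ← map_mul, hinv, map_one, map_one]
  · set B := Algebra.adjoin K {ρ (.inl (.ofAdd 1)), ρ (.inr (.ofAdd 1))} with hB
    have hl : ρ (.inl (.ofAdd 1)) ∈ B := Algebra.subset_adjoin (by simp)
    have hr : ρ (.inr (.ofAdd 1)) ∈ B := Algebra.subset_adjoin (by simp)
    have hρ (x) : ρ x ∈ B := by
      induction x using Monoid.Coprod.induction_on with
      | inl m =>
        rw [multiplicative_zmod_eq_pow two_ne_zero m, map_pow, map_pow]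
        exact pow_mem hl _
      | inr m =>
        rw [multiplicative_zmod_eq_pow two_ne_zero m, map_pow, map_pow]
        exact pow_mem hr _
      | mul x y hx hy =>
        rw [map_mul]
        exact mul_mem hx hy
    have hsymm (x) : e.symm x ∈ B := by
      induction x using MonoidAlgebra.induction_on with
      | of m => exact hρ m
      | add x y hx hy =>
        rw [map_add]
        exact add_mem hx hy
      | smul c x hx =>
        rw [map_smul]
        exact B.smul_mem hx c
    exact Algebra.eq_top_iff.mpr fun a => e.symm_apply_apply a ▸ hsymm (e a)

end FDRightModule

/-- The free product of two cyclic groups of order two, as an indexed and as a binary free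
product. -/
def coprodITwoEquivCoprod (G : Type*) [Group G] :
    Monoid.CoprodI (fun _ : Fin 2 => G) ≃* Monoid.Coprod G G :=
  MonoidHom.toMulEquiv
    (Monoid.CoprodI.lift ![Monoid.Coprod.inl, Monoid.Coprod.inr])
    (Monoid.Coprod.lift (Monoid.CoprodI.of (M := fun _ : Fin 2 => G) (i := 0))
      (Monoid.CoprodI.of (M := fun _ : Fin 2 => G) (i := 1)))
    (by
      apply Monoid.CoprodI.ext_hom
      intro i
      ext x
      fin_cases i <;> simp)
    (by ext x <;> simp)

/-! ### Semisimplicity, finiteness and boundedness -/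

theorem proposition5p4 (K : Type u) [Field K] [IsAlgClosed K] [CharZero K]
    (n : ℕ) (hn : 1 ≤ n) (k : Fin n → ℕ) (hk : ∀ j, 1 < k j) :
    -- the algebra given by the presentation is the group algebra of the free product
    Nonempty (CyclicAlgebra K k ≃ₐ[K] MonoidAlgebra K (CyclicFreeProduct k)) ∧
    -- part (a)
    List.TFAE
      [FDRightModule.IsSemisimpleCat K (CyclicAlgebra K k),
        (FDRightModule.simpleClasses K (CyclicAlgebra K k)).Finite,
        n = 1,
        Finite (CyclicFreeProduct k) ∧ IsCyclic (CyclicFreeProduct k)] ∧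
    -- part (b)
    ((FDRightModule.simpleClasses K (CyclicAlgebra K k)).Infinite →
      List.TFAE
        [FDRightModule.HasBoundedSimples K (CyclicAlgebra K k),
          n = 2 ∧ ∀ j, k j = 2,
          Nonempty (CyclicFreeProduct k ≃*
            Monoid.Coprod (Multiplicative (ZMod 2)) (Multiplicative (ZMod 2)))]) := by
  have hk0 (j : Fin n) : k j ≠ 0 := (Nat.zero_lt_of_lt (hk j)).ne'
  obtain ⟨e⟩ := nonempty_cyclicAlgebra_algEquiv K k hk0
  have hcyc : n = 1 → Finite (CyclicFreeProduct k) ∧ IsCyclic (CyclicFreeProduct k) := by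
    intro h
    have : Subsingleton (Fin n) := Fin.subsingleton_iff_le_one.mpr h.le
    exact finite_and_isCyclic_of_subsingleton k hn hk0
  have hss : Finite (CyclicFreeProduct k) ∧ IsCyclic (CyclicFreeProduct k) →
      IsSemisimpleRing (CyclicAlgebra K k)ᵐᵒᵖ := by
    rintro ⟨hfin, -⟩
    exact FDRightModule.isSemisimpleRing_op_of_finite e
  have hfin : Finite (CyclicFreeProduct k) ∧ IsCyclic (CyclicFreeProduct k) →
      (FDRightModule.simpleClasses K (CyclicAlgebra K k)).Finite := by
    intro h
    have := hss h
    exact FDRightModule.finite_simpleClasses_of_isSemisimpleRing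
  refine ⟨⟨e⟩, ?_, fun hinf => ?_⟩
  · tfae_have 3 → 4 := hcyc
    tfae_have 4 → 1 := by
      intro h M
      have := hss h
      infer_instance
    tfae_have 4 → 2 := hfin
    tfae_have 1 → 3 := FDRightModule.eq_one_of_isSemisimpleCat hk hn
    tfae_have 2 → 3 := by
      intro h
      by_contra hn1
      exact FDRightModule.infinite_simpleClasses hk (by omega) h
    tfae_finish
  · have hn2 : 2 ≤ n := by
      by_contra hlt
      exact hinf (hfin (hcyc (by omega)))
    tfae_have 1 → 2 := FDRightModule.eq_two_of_hasBoundedSimples hk hn2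
    tfae_have 2 → 3 := by
      rintro ⟨rfl, h2⟩
      obtain rfl : k = fun _ => 2 := funext h2
      exact ⟨coprodITwoEquivCoprod _⟩
    tfae_have 3 → 1 := by
      rintro ⟨φ⟩
      exact FDRightModule.hasBoundedSimples_of_dihedral
        (e.trans (MonoidAlgebra.domCongr K K φ))
    tfae_finish
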